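/- Let $s\in\mathbb{N}$, let $\mathbf p=(p_1,\dots,p_s)$ be mutually different primes and let $\gamma_1,\dots,\gamma_s>0$. For a prime $p$ let $\mathbb{Z}_p$ be the additive group of $p$-adic integers $z=\sum_{r\ge 0}z_rp^r$, $z_r\in\{0,\dots,p-1\}$. Let $\phi_p:\mathbb{Z}_p\to[0,1)$, $\phi_p(z)=\sum_{r\ge0}z_rp^{-r-1}\pmod 1$, and $\phi_p^+:[0,1)\to\mathbb{Z}_p$, $\phi_p^+\bigl(\sum_{r\ge0}x_rp^{-r-1}\bigr)=\sum_{r\ge0}x_rp^r$, where the finite base-$p$ expansion is used whenever $x$ has one. For $k\in\mathbb{N}_0$ and $x,\sigma\in[0,1)$ put $\beta_{p,k}(x)=e^{2\pi i\,\phi_p(k)\,\phi_p^+(x)}$ (well defined, since $\phi_p(k)\in p^{-a}\mathbb{Z}$ for some $a$, so only $\phi_p^+(x)$ modulo $p^a$ matters) and $x\oplus_p\sigma=\phi_p(\phi_p^+(x)+\phi_p^+(\sigma))$. For $\mathbf k\in\mathbb{N}_0^s$ and $\mathbf x,\boldsymbol\sigma\in[0,1)^s$ let $\beta_{\mathbf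 k}(\mathbf x)=\prod_{j=1}^s\beta_{p_j,k_j}(x_j)$ and $\mathbf x\oplus_{\mathbf p}\boldsymbol\sigma=(x_j\oplus_{p_j}\sigma_j)_{j=1}^s$. Let $$K_{s,\boldsymbol\gamma}(\mathbf x,\mathbf y)=\prod_{j=1}^s\bigl(1+\gamma_j\min(1-x_j,1-y_j)\bigr)$$ be the kernel of the weighted Sobolev space anchored at $(1,\dots,1)$, and let $$K_{\mathrm{sh}}(\mathbf x,\mathbf y)=\int_{[0,1]^s}K_{s,\boldsymbol\gamma}(\mathbf x\oplus_{\mathbf p}\boldsymbol\sigma,\mathbf y\oplus_{\mathbf p}\boldsymbol\sigma)\,d\boldsymbol\sigma$$ be its $\mathbf p$-adic shift-invariant kernel. Then for all $\mathbf x,\mathbf y\in[0,1)^s$ the integrand is integrable, and $$K_{\mathrm{sh}}(\mathbf x,\mathbf y)=\sum_{\mathbf k\in\mathbb{N}_0^s}r_{\mathbf p,\boldsymbol\gamma}(\mathbf k)\,\beta_{\mathbf k}(\mathbf x)\,\overline{\beta_{\mathbf k}(\mathbf y)}$$ with an absolutely convergent series, where $r_{\mathbf p,\boldsymbol\gamma}(\mathbf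 k)=\prod_{j=1}^sr_{p_j,\gamma_j}(k_j)$, $r_{p,\gamma}(0)=1+\frac{\gamma}{3}$, and, for $k=\kappa_{a-1}p^{a-1}+\dots+\kappa_1p+\kappa_0>0$ with digits $\kappa_i\in\{0,\dots,p-1\}$ and $\kappa_{a-1}\ne0$, $$r_{p,\gamma}(k)=\frac{\gamma}{2p^{2a}}\left(\frac{1}{\sin^2(\kappa_{a-1}\pi/p)}-\frac13\right).$$ -/

import Mathlib

open MeasureTheory

noncomputable section

namespace PAdicShift

/-- The digit `z_r ∈ {0, …, p - 1}` in the expansion `z = ∑_r z_r p ^ r` of a `p`-adic integer: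
the residue of `z` modulo `p ^ (r + 1)`, taken in `{0, …, p ^ (r + 1) - 1}`, divided by `p ^ r`
with the remainder discarded. -/
def digit (p : ℕ) [Fact p.Prime] (z : ℤ_[p]) (r : ℕ) : Fin p :=
  Fin.ofNat p ((PadicInt.toZModPow (r + 1) z).val / p ^ r)

/-- The Monna map `φ_p : ℤ_p → [0, 1)`, `φ_p(z) = ∑_r z_r / p ^ (r + 1) (mod 1)`. -/
def monna (p : ℕ) [Fact p.Prime] (z : ℤ_[p]) : ℝ :=
  Int.fract (Real.ofDigits (digit p z))

/-- The inverse `φ_p⁺ : [0, 1) → ℤ_p`, `∑_r x_r / p ^ (r + 1) ↦ ∑_r x_r p ^ r`. The digits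
`x_r = ⌊x p ^ (r + 1)⌋ mod p` given by `Real.digits` are those of the finite expansion whenever `x`
is a `p`-adic rational. Only used for `x ∈ [0, 1)`. -/
def monnaInv (p : ℕ) [Fact p.Prime] (x : ℝ) : ℤ_[p] :=
  ∑' r : ℕ, ((Real.digits x p r : ℕ) : ℤ_[p]) * (p : ℤ_[p]) ^ r

/-- The character `χ_k(z) = exp(2 π i φ_p(k) z)` of `ℤ_p`. If `k` has `a` digits in base `p`, then
`φ_p(k)` is a rational with denominator dividing `p ^ a`, so the exponential depends only on `z`
modulo `p ^ a`; `z` is replaced by its representative modulo `p ^ a`. -/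
def chi (p : ℕ) [Fact p.Prime] (k : ℕ) (z : ℤ_[p]) : ℂ :=
  Complex.exp (2 * (Real.pi : ℂ) * Complex.I * ((monna p (k : ℤ_[p]) : ℝ) : ℂ) *
    (((PadicInt.toZModPow (Nat.digits p k).length z).val : ℕ) : ℂ))

/-- The `p`-adic function `β_k(x) = χ_k(φ_p⁺(x))`, for `x ∈ [0, 1)`. -/
def beta (p : ℕ) [Fact p.Prime] (k : ℕ) (x : ℝ) : ℂ :=
  chi p k (monnaInv p x)

/-- The `p`-adic shift `x ⊕_p σ = φ_p(φ_p⁺(x) + φ_p⁺(σ))`, for `x, σ ∈ [0, 1)`. -/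
def shift (p : ℕ) [Fact p.Prime] (x σ : ℝ) : ℝ :=
  monna p (monnaInv p x + monnaInv p σ)

/-- The coefficient `r_{p,γ}(k)`; for `k > 0` with `a` digits in base `p` and leading digit
`κ = κ_{a-1}` it is `γ / (2 p ^ (2 a)) * (1 / sin² (κ π / p) - 1 / 3)`. -/
def coeff (p : ℕ) (γ : ℝ) (k : ℕ) : ℝ :=
  if k = 0 then 1 + γ / 3
  else
    let a : ℕ := (Nat.digits p k).length
    let κ : ℕ := (Nat.digits p k).getD (a - 1) 0
    γ / (2 * (p : ℝ) ^ (2 * a)) * (1 / Real.sin ((κ : ℝ) * Real.pi / (p : ℝ)) ^ 2 - 1 / 3)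

variable {s : ℕ}

/-- The half-open unit cube `[0, 1)^s`. -/
def unitCube (s : ℕ) : Set (Fin s → ℝ) :=
  Set.univ.pi fun _ => Set.Ico (0 : ℝ) 1

/-- `β_k(x) = ∏_j β_{k_j}(x_j)` for `k ∈ ℕ₀^s`, `x ∈ [0, 1)^s`, in bases `p = (p_1, …, p_s)`. -/
def betaVec (p : Fin s → ℕ) [∀ j, Fact (p j).Prime] (k : Fin s → ℕ) (x : Fin s → ℝ) : ℂ :=
  ∏ j, beta (p j) (k j) (x j)

/-- The coordinatewise shift `x ⊕_p σ` on `[0, 1)^s`. -/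
def shiftVec (p : Fin s → ℕ) [∀ j, Fact (p j).Prime] (x σ : Fin s → ℝ) : Fin s → ℝ :=
  fun j => shift (p j) (x j) (σ j)

/-- `r_{p,γ}(k) = ∏_j r_{p_j,γ_j}(k_j)`. -/
def coeffVec (p : Fin s → ℕ) (γ : Fin s → ℝ) (k : Fin s → ℕ) : ℝ :=
  ∏ j, coeff (p j) (γ j) (k j)

/-- The kernel `K_{s,γ}(x, y) = ∏_j (1 + γ_j min(1 - x_j, 1 - y_j))` of the weighted anchored
Sobolev space with anchor `(1, …, 1)`. -/
def sobolevKernel (γ : Fin s → ℝ) (x y : Fin s → ℝ) : ℝ :=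
  ∏ j, (1 + γ j * min (1 - x j) (1 - y j))

/-- The shift-invariant kernel `K_sh(x, y) = ∫ K(x ⊕_p σ, y ⊕_p σ) dσ` of a kernel `K`. The shift
is defined for `σ ∈ [0, 1)^s`, which is `[0, 1]^s` up to a null set. -/
def shiftInvariantKernel (p : Fin s → ℕ) [∀ j, Fact (p j).Prime]
    (K : (Fin s → ℝ) → (Fin s → ℝ) → ℝ) (x y : Fin s → ℝ) : ℝ :=
  ∫ σ in unitCube s, K (shiftVec p x σ) (shiftVec p y σ)

end PAdicShift

end

namespace PAdicShift

open Finset Filter Topology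

/-! Kernel, shift and coefficients all factor over the coordinates, so Fubini
(`integral_fintype_prod_eq_prod`) and the product of absolutely convergent series
(`hasSum_fin_prod`) reduce the claim to one prime, `hasSum_term`.

For one prime, truncate at `N` digits. Let `V` be the residue of φ⁺(x) - φ⁺(y) modulo p^N. The first
`N` digits of a uniform σ form a uniform residue `c`, and applying φ_p amounts to reversing digits.
Since min(1-a, 1-b) = 1 - (a+b)/2 - |a-b|/2, the truncated integral is 1 + γ/2 - (γ/2) `revDist p N
V` / p^(2N), up to a term of order p^(-N) (`average_kernel`).

The partial sum of the series over k < p^N has the same form up to O(p^(-N)) (`partialSeries_eq`).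
This is an induction on `N`. While p^N divides `V`, both sides are explicit. Once it does not,
`revDist` only scales by p², and the block p^N ≤ k < p^(N+1) contributes nothing, by orthogonality
of characters. The transition between the two regimes needs the finite Fourier transform of
1/sin²(kπ/p), which is quadratic in the residue (`cscSqSum_eq`).

Letting N tend to infinity, with dominated convergence on the integral side, identifies the two
limits. -/

/-! ### Sums over residues. -/

theorem sum_range_mul {M : Type*} [AddCommMonoid M] (f : ℕ → M) (a b : ℕ) :
    ∑ i ∈ range (a * b), f i = ∑ i ∈ range a, ∑ j ∈ range b, f (i + a * j) := by
  induction b with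
  | zero => simp
  | succ b ih =>
    rw [Nat.mul_succ, sum_range_add, ih, ← sum_add_distrib]
    refine sum_congr rfl fun i _ => ?_
    rw [sum_range_succ, add_comm (a * b) i]

theorem sum_range_add_of_periodic {M : Type*} [AddCommGroup M] (f : ℕ → M) (m : ℕ)
    (hf : Function.Periodic f m) (v : ℕ) :
    ∑ i ∈ range m, f (v + i) = ∑ i ∈ range m, f i := by
  induction v with
  | zero => simp
  | succ v ih =>
    rw [← ih]
    have h1 := sum_range_succ (fun i => f (v + i)) m
    have h2 := sum_range_succ' (fun i => f (v + i)) m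
    rw [h1, hf v, add_zero] at h2
    simpa [add_assoc, add_comm, add_left_comm] using (add_right_cancel h2).symm

theorem sum_mod_add {M : Type*} [AddCommGroup M] (f : ℕ → M) (p v : ℕ) :
    ∑ i ∈ range p, f ((v + i) % p) = ∑ i ∈ range p, f i := by
  rw [sum_range_add_of_periodic (fun i => f (i % p)) p (fun i => by simp) v]
  exact sum_congr rfl fun i hi => by rw [Nat.mod_eq_of_lt (mem_range.1 hi)]

/-! ### Digit reversal. -/

/-- The number whose base-`p` digits are the lowest `N` digits of `n` in reverse order. -/
def revDigits (p : ℕ) : ℕ → ℕ → ℕ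
  | 0, _ => 0
  | N + 1, n => p * revDigits p N n + n / p ^ N % p

theorem revDigits_lt {p : ℕ} (hp : 0 < p) (N n : ℕ) : revDigits p N n < p ^ N := by
  induction N with
  | zero => simp [revDigits]
  | succ N ih =>
    have := Nat.mod_lt (n / p ^ N) hp
    rw [revDigits, pow_succ]
    nlinarith

theorem div_pow_mod_eq_of_modEq {p N m n : ℕ} (h : m ≡ n [MOD p ^ (N + 1)]) :
    m / p ^ N % p = n / p ^ N % p := by
  rw [← Nat.mod_mul_right_div_self, ← Nat.mod_mul_right_div_self, ← pow_succ, h]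

theorem revDigits_congr {p N m n : ℕ} (h : m ≡ n [MOD p ^ N]) :
    revDigits p N m = revDigits p N n := by
  induction N with
  | zero => rfl
  | succ N ih =>
    rw [revDigits, revDigits, ih (h.of_dvd (pow_dvd_pow p N.le_succ)), div_pow_mod_eq_of_modEq h]

/-- Division by `p` strips the last digit of a reversal, which is the highest retained digit of the
number; the remaining digits are compared by induction. -/
theorem modEq_of_revDigits_eq {p : ℕ} (hp : 0 < p) {N m n : ℕ}
    (h : revDigits p N m = revDigits p N n) : m ≡ n [MOD p ^ N] := by
  induction N with
  | zero => simp [Nat.modEq_one]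
  | succ N ih =>
    rw [revDigits, revDigits] at h
    have hm := Nat.mod_lt (m / p ^ N) hp
    have hn := Nat.mod_lt (n / p ^ N) hp
    have hd : revDigits p N m = revDigits p N n := by
      have := congrArg (· / p) h
      simpa [Nat.mul_add_div hp, Nat.div_eq_of_lt hm, Nat.div_eq_of_lt hn] using this
    rw [hd] at h
    have h' := ih hd
    rw [Nat.ModEq, Nat.mod_pow_succ, Nat.mod_pow_succ, h', Nat.add_left_cancel h]

/-- Reversal permutes the residues modulo p^N, so this is the sum of 0, …, p^N - 1. -/
theorem sum_revDigits (p N : ℕ) :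
    2 * ∑ c ∈ range (p ^ N), (revDigits p N c : ℝ) = (p : ℝ) ^ N * ((p : ℝ) ^ N - 1) := by
  rcases Nat.eq_zero_or_pos p with rfl | hp
  · cases N <;> simp [revDigits]
  induction N with
  | zero => simp [revDigits]
  | succ N ih =>
    have hN : 0 < p ^ N := pow_pos hp N
    have key : ∀ i ∈ range (p ^ N), ∑ j ∈ range p, (revDigits p (N + 1) (i + p ^ N * j) : ℝ)
        = (p : ℝ) * p * revDigits p N i + (p : ℝ) * (p - 1) / 2 := by
      intro i hi
      have : ∀ j ∈ range p, (revDigits p (N + 1) (i + p ^ N * j) : ℝ)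
          = p * revDigits p N i + j := by
        intro j hj
        rw [revDigits, revDigits_congr (show i + p ^ N * j ≡ i [MOD p ^ N] by simp [Nat.ModEq]),
          Nat.add_mul_div_left _ _ hN, Nat.div_eq_of_lt (mem_range.1 hi), zero_add,
          Nat.mod_eq_of_lt (mem_range.1 hj)]
        push_cast; rfl
      rw [sum_congr rfl this, sum_add_distrib, sum_const, card_range, nsmul_eq_mul]
      have h2 : (∑ j ∈ range p, (j : ℝ)) * 2 = p * (p - 1) := by
        have := Finset.sum_range_id_mul_two p
        have h3 : ((∑ j ∈ range p, j : ℕ) : ℝ) * 2 = p * ((p - 1 : ℕ) : ℝ) := by exact_mod_cast this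
        rw [Nat.cast_sub hp] at h3
        simpa using h3
      linarith
    rw [pow_succ, sum_range_mul, sum_congr rfl key, sum_add_distrib, ← mul_sum, sum_const,
      card_range, nsmul_eq_mul]
    push_cast
    rw [pow_succ]
    linear_combination (p : ℝ) * p * ih

/-! ### Total distance between reversals of translates. -/

/-- The sum of the distances between the reversals of `v + c` and of `c`, for `c` modulo `p ^ N`. -/
def revDist (p N v : ℕ) : ℤ :=
  ∑ c ∈ range (p ^ N), |(revDigits p N (v + c) : ℤ) - revDigits p N c|

theorem revDist_eq_zero {p N v : ℕ} (h : p ^ N ∣ v) : revDist p N v = 0 := by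
  refine sum_eq_zero fun c _ => ?_
  rw [revDigits_congr (show v + c ≡ c [MOD p ^ N] from ?_), sub_self, abs_zero]
  simpa using (Nat.modEq_zero_iff_dvd.2 h).add_right c

theorem abs_mul_add_of_abs_lt {a d : ℤ} {p : ℤ} (ha : a ≠ 0) (hd : |d| < p) :
    |p * a + d| = p * |a| + a.sign * d := by
  have hp : 0 < p := (abs_nonneg d).trans_lt hd
  obtain ⟨h1, h2⟩ := abs_lt.1 hd
  rcases lt_or_gt_of_ne ha with h | h
  · rw [Int.sign_eq_neg_one_of_neg h, abs_of_neg h, abs_of_nonpos] <;> nlinarith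
  · rw [Int.sign_eq_one_of_pos h, abs_of_pos h, abs_of_nonneg] <;> nlinarith

theorem abs_mod_sub_mod_lt {p : ℕ} (hp : 0 < p) (a b : ℕ) :
    |((a % p : ℕ) : ℤ) - (b % p : ℕ)| < p := by
  have := Nat.mod_lt a hp
  have := Nat.mod_lt b hp
  rw [abs_lt]; omega

/-- The two reversals already differ, by `a ≠ 0`, after `N` digits, so the next digits change the
distance only through `a.sign` times their difference. As the new digit `j` runs over all values,
both digits run over all residues modulo `p` and the differences cancel. One factor `p` is the shift
in place value, the other counts the `j`. -/
theorem revDist_succ_of_not_dvd {p N v : ℕ} (hp : 0 < p) (h : ¬ p ^ N ∣ v) :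
    revDist p (N + 1) v = p ^ 2 * revDist p N v := by
  have hN : 0 < p ^ N := pow_pos hp N
  rw [revDist, pow_succ, sum_range_mul, revDist, mul_sum]
  refine sum_congr rfl fun c _ => ?_
  set a : ℤ := (revDigits p N (v + c) : ℤ) - revDigits p N c with ha
  have ha0 : a ≠ 0 := by
    intro h0
    have h1 : revDigits p N (v + c) = revDigits p N c := by omega
    have h2 := modEq_of_revDigits_eq hp h1
    have h3 : v + c ≡ 0 + c [MOD p ^ N] := by simpa using h2
    exact h ((Nat.modEq_zero_iff_dvd).1 (Nat.ModEq.add_right_cancel' c h3))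
  have key : ∀ j ∈ range p,
      |(revDigits p (N + 1) (v + (c + p ^ N * j)) : ℤ) - revDigits p (N + 1) (c + p ^ N * j)|
      = p * |a| + a.sign * ((((v + c) / p ^ N + j) % p : ℕ) - ((c / p ^ N + j) % p : ℕ)) := by
    intro j _
    rw [← abs_mul_add_of_abs_lt ha0 (abs_mod_sub_mod_lt hp _ _), ← add_assoc, revDigits, revDigits,
      revDigits_congr (show v + c + p ^ N * j ≡ v + c [MOD p ^ N] by simp [Nat.ModEq]),
      revDigits_congr (show c + p ^ N * j ≡ c [MOD p ^ N] by simp [Nat.ModEq]),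
      Nat.add_mul_div_left _ _ hN, Nat.add_mul_div_left _ _ hN, ha]
    congr 1
    push_cast
    ring
  rw [sum_congr rfl key, sum_add_distrib, sum_const, ← mul_sum, sum_sub_distrib,
    sum_mod_add (fun i => (i : ℤ)), sum_mod_add (fun i => (i : ℤ)), card_range, nsmul_eq_mul]
  ring

/-- Translation by `d` does not wrap for `p - d` values of `j`, each at distance `d`, and wraps for
`d` values, each at distance `p - d`. -/
theorem sum_abs_mod_sub (p d : ℕ) (hd : d < p) :
    ∑ j ∈ range p, |(((d + j) % p : ℕ) : ℤ) - j| = 2 * d * (p - d) := by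
  obtain ⟨e, rfl⟩ := Nat.exists_eq_add_of_le hd.le
  rw [add_comm d e, sum_range_add]
  have h1 : ∀ j ∈ range e, |(((d + j) % (e + d) : ℕ) : ℤ) - j| = d := by
    intro j hj
    have := mem_range.1 hj
    rw [Nat.mod_eq_of_lt (by omega)]
    push_cast
    rw [add_sub_cancel_right]; exact abs_of_nonneg (by positivity)
  have h2 : ∀ j ∈ range d, |(((d + (e + j)) % (e + d) : ℕ) : ℤ) - ((e + j : ℕ) : ℤ)| = e := by
    intro j hj
    have := mem_range.1 hj
    rw [show d + (e + j) = j + (e + d) by ring, Nat.add_mod_right, Nat.mod_eq_of_lt (by omega)]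
    push_cast
    rw [abs_sub_comm, add_sub_cancel_right]; exact abs_of_nonneg (by positivity)
  rw [sum_congr rfl h1, sum_congr rfl h2]
  simp
  ring

/-- Adding a multiple of p^N leaves the lower `N` digits alone and rotates the top digit by `q`
modulo `p`, whatever `c` is. -/
theorem revDist_succ_mul {p : ℕ} (hp : 0 < p) (N q : ℕ) :
    revDist p (N + 1) (p ^ N * q) = p ^ N * (2 * (q % p : ℕ) * (p - (q % p : ℕ))) := by
  have hN : 0 < p ^ N := pow_pos hp N
  rw [revDist, pow_succ, sum_range_mul]
  have key : ∀ c ∈ range (p ^ N), ∑ j ∈ range p,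
      |(revDigits p (N + 1) (p ^ N * q + (c + p ^ N * j)) : ℤ) -
        revDigits p (N + 1) (c + p ^ N * j)| = 2 * (q % p : ℕ) * (p - (q % p : ℕ)) := by
    intro c hc
    rw [← sum_abs_mod_sub p (q % p) (Nat.mod_lt _ hp)]
    refine sum_congr rfl fun j hj => ?_
    rw [show p ^ N * q + (c + p ^ N * j) = c + p ^ N * (q + j) by ring, revDigits, revDigits,
      revDigits_congr (show c + p ^ N * (q + j) ≡ c [MOD p ^ N] by simp [Nat.ModEq]),
      revDigits_congr (show c + p ^ N * j ≡ c [MOD p ^ N] by simp [Nat.ModEq]),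
      Nat.add_mul_div_left _ _ hN, Nat.add_mul_div_left _ _ hN,
      Nat.div_eq_of_lt (mem_range.1 hc), zero_add, zero_add, Nat.mod_add_mod,
      Nat.mod_eq_of_lt (mem_range.1 hj)]
    congr 1
    push_cast
    ring
  rw [sum_congr rfl key]
  simp

/-! ### Exponentials and sums of roots of unity. -/

/-- `e(x) = exp(2 π i x)`. -/
noncomputable def expTwoPi (x : ℝ) : ℂ := Complex.exp (2 * (Real.pi : ℂ) * Complex.I * (x : ℂ))

theorem expTwoPi_add (x y : ℝ) : expTwoPi (x + y) = expTwoPi x * expTwoPi y := by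
  rw [expTwoPi, expTwoPi, expTwoPi, ← Complex.exp_add]; push_cast; ring_nf

theorem expTwoPi_natCast (n : ℕ) : expTwoPi n = 1 := by
  rw [expTwoPi]
  have := Complex.exp_nat_mul_two_pi_mul_I n
  rw [← this]; push_cast; ring_nf

theorem expTwoPi_zero : expTwoPi 0 = 1 := by simp [expTwoPi]

theorem expTwoPi_nat_mul (n : ℕ) (x : ℝ) : expTwoPi (n * x) = expTwoPi x ^ n := by
  rw [expTwoPi, expTwoPi, ← Complex.exp_nat_mul]; push_cast; ring_nf

theorem norm_expTwoPi (x : ℝ) : ‖expTwoPi x‖ = 1 := by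
  rw [expTwoPi, show 2 * (Real.pi : ℂ) * Complex.I * (x : ℂ) = ((2 * Real.pi * x : ℝ) : ℂ) * Complex.I
    by push_cast; ring]
  exact Complex.norm_exp_ofReal_mul_I _

theorem sum_expTwoPi {p : ℕ} (hp : 0 < p) (q : ℕ) :
    ∑ k ∈ range p, expTwoPi (k * (q / p)) = if p ∣ q then (p : ℂ) else 0 := by
  have hp' : (p : ℝ) ≠ 0 := by positivity
  simp_rw [expTwoPi_nat_mul]
  split_ifs with h
  · obtain ⟨m, rfl⟩ := h
    have : expTwoPi (((p * m : ℕ) : ℝ) / p) = 1 := by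
      rw [Nat.cast_mul, mul_div_cancel_left₀ _ hp', expTwoPi_natCast]
    simp only [this, one_pow, sum_const, card_range, nsmul_eq_mul, mul_one]
  · have hpow : expTwoPi ((q : ℝ) / p) ^ p = 1 := by
      rw [← expTwoPi_nat_mul, mul_div_cancel₀ _ hp', expTwoPi_natCast]
    have hne : expTwoPi ((q : ℝ) / p) ≠ 1 := by
      intro h1
      have hω := Complex.isPrimitiveRoot_exp p hp.ne'
      have : expTwoPi ((q : ℝ) / p) = Complex.exp (2 * Real.pi * Complex.I / p) ^ q := by
        rw [expTwoPi, ← Complex.exp_nat_mul]; push_cast; ring_nf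
      rw [this] at h1
      exact h ((hω.pow_eq_one_iff_dvd q).1 h1)
    rw [geom_sum_eq hne, hpow]; simp

/-- This is the symbol of the second difference; its sin² cancels the denominator in `cscSqSum`. -/
theorem sq_expTwoPi_sub_one (x : ℝ) :
    (expTwoPi x - 1) ^ 2 = -4 * (Real.sin (x * Real.pi) : ℂ) ^ 2 * expTwoPi x := by
  have h1 : expTwoPi x = Complex.exp ((x * Real.pi : ℂ) * Complex.I) ^ 2 := by
    rw [expTwoPi, ← Complex.exp_nat_mul]; push_cast; ring_nf
  have h2 := Complex.exp_mul_I (x * Real.pi : ℂ)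
  have h3 := Complex.sin_sq_add_cos_sq (x * Real.pi : ℂ)
  rw [h1, h2]
  push_cast
  set s := Complex.sin (x * Real.pi : ℂ)
  set c := Complex.cos (x * Real.pi : ℂ)
  have hc : c ^ 2 = 1 - s ^ 2 := by linear_combination h3
  have hI := Complex.I_sq
  have e1 : (c + s * Complex.I) ^ 2 - 1 = 2 * s * Complex.I * (c + s * Complex.I) := by
    linear_combination hc - s ^ 2 * hI
  rw [e1]
  linear_combination 4 * s ^ 2 * (c + s * Complex.I) ^ 2 * hI

theorem sin_pos_of_mem_Ico {p k : ℕ} (hk : k ∈ Ico 1 p) :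
    0 < Real.sin (k * Real.pi / p) := by
  obtain ⟨h1, h2⟩ := mem_Ico.1 hk
  have hp : (0 : ℝ) < p := by exact_mod_cast (by omega : 0 < p)
  have hk0 : (0 : ℝ) < k := by exact_mod_cast h1
  have hkp : (k : ℝ) < p := by exact_mod_cast h2
  refine Real.sin_pos_of_pos_of_lt_pi (by positivity) ?_
  rw [div_lt_iff₀ hp]
  nlinarith [Real.pi_pos]

theorem sum_Ico_expTwoPi {p : ℕ} (hp : 0 < p) (q : ℕ) :
    ∑ k ∈ Ico 1 p, expTwoPi (k * (q / p)) = (if p ∣ q then (p : ℂ) else 0) - 1 := by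
  rw [← sum_expTwoPi hp q, range_eq_Ico, sum_eq_sum_Ico_succ_bot hp]
  simp [expTwoPi_zero]

/-! ### The finite Fourier transform of 1/sin². -/

/-- The discrete Fourier transform of `1 / sin² (k π / p)`. -/
noncomputable def cscSqSum (p q : ℕ) : ℂ :=
  ∑ k ∈ Ico 1 p, expTwoPi (k * (q / p)) / (Real.sin (k * Real.pi / p) : ℂ) ^ 2

/-- Each summand becomes -4 e(k(q+1)/p), and the nontrivial roots of unity sum to -1. -/
theorem cscSqSum_second_diff {p : ℕ} (hp : 0 < p) {q : ℕ} (h : ¬ p ∣ q + 1) :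
    cscSqSum p (q + 2) - 2 * cscSqSum p (q + 1) + cscSqSum p q = 4 := by
  have h1 := sum_Ico_expTwoPi hp (q + 1)
  rw [if_neg h] at h1
  rw [cscSqSum, cscSqSum, cscSqSum, mul_sum, ← sum_sub_distrib, ← sum_add_distrib,
    show (4 : ℂ) = -4 * (0 - 1) by ring, ← h1, mul_sum]
  refine sum_congr rfl fun k hk => ?_
  have hs : (Real.sin (k * Real.pi / p) : ℂ) ≠ 0 := by
    exact_mod_cast (sin_pos_of_mem_Ico hk).ne'
  have e := sq_expTwoPi_sub_one ((k : ℝ) / p)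
  rw [show (k : ℝ) / p * Real.pi = k * Real.pi / p by ring] at e
  have e1 : expTwoPi (k * (((q + 1 : ℕ) : ℝ) / p)) = expTwoPi (k * (q / p)) * expTwoPi (k / p) := by
    rw [← expTwoPi_add]; push_cast; ring_nf
  have e2 : expTwoPi (k * (((q + 2 : ℕ) : ℝ) / p))
      = expTwoPi (k * (q / p)) * expTwoPi (k / p) ^ 2 := by
    rw [pow_two, ← expTwoPi_add, ← expTwoPi_add]; push_cast; ring_nf
  rw [e1, e2]
  generalize expTwoPi (k * (q / p)) = u
  field_simp
  linear_combination u * e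

theorem cscSqSum_mod {p : ℕ} (hp : 0 < p) (q : ℕ) : cscSqSum p q = cscSqSum p (q % p) := by
  refine sum_congr rfl fun k _ => ?_
  congr 1
  have hp' : (p : ℝ) ≠ 0 := by positivity
  have : (q : ℝ) = p * (q / p : ℕ) + (q % p : ℕ) := by exact_mod_cast (Nat.div_add_mod q p).symm
  rw [this, show (k : ℝ) * ((p * (q / p : ℕ) + (q % p : ℕ)) / p)
    = (k * (q / p) : ℕ) + k * ((q % p : ℕ) / p) by push_cast; field_simp, expTwoPi_add,
    expTwoPi_natCast, one_mul]

theorem eq_linear_of_second_diff {f : ℕ → ℂ} {p : ℕ}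
    (h : ∀ q, q + 2 ≤ p → f (q + 2) - 2 * f (q + 1) + f q = 0) (q : ℕ) (hq : q ≤ p) :
    f q = f 0 + q * (f 1 - f 0) := by
  induction q using Nat.twoStepInduction with
  | zero => simp
  | one => simp
  | more q ih1 ih2 =>
    have := h q hq
    have a := ih1 (by omega)
    have b := ih2 (by omega)
    push_cast at *
    linear_combination this + 2 * b - a

theorem cscSqSum_sub_zero {p : ℕ} (hp : 0 < p) (q : ℕ) (hq : q ≤ p) :
    cscSqSum p q = cscSqSum p 0 - 2 * q * (p - q) := by
  -- The added quadratic has second difference -4, so `f` is linear on 0, …, p; periodicity gives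
  -- equal endpoint values, hence `f` is constant.
  set f : ℕ → ℂ := fun q => cscSqSum p q + 2 * q * (p - q) with hf
  have h2 : ∀ q, q + 2 ≤ p → f (q + 2) - 2 * f (q + 1) + f q = 0 := by
    intro q hq
    have := cscSqSum_second_diff hp (q := q) (fun h => by have := Nat.le_of_dvd (by omega) h; omega)
    simp only [hf]
    push_cast
    linear_combination this
  have hp0 : (p : ℂ) ≠ 0 := by exact_mod_cast hp.ne'
  have hpp := eq_linear_of_second_diff h2 p le_rfl
  have e : f p = f 0 := by
    simp only [hf]
    rw [cscSqSum_mod hp p]; simp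
  have h10 : f 1 - f 0 = 0 := by
    have : (p : ℂ) * (f 1 - f 0) = 0 := by linear_combination e - hpp
    simpa [hp0] using this
  have := eq_linear_of_second_diff h2 q hq
  rw [h10] at this
  simp only [hf] at this
  push_cast at this
  linear_combination this

/-- This fixes the constant left open by the second-difference argument. -/
theorem sum_cscSqSum {p : ℕ} (hp : 0 < p) : ∑ q ∈ range p, cscSqSum p q = 0 := by
  simp only [cscSqSum]
  rw [sum_comm]
  refine sum_eq_zero fun k hk => ?_
  rw [← sum_div]
  have h := sum_expTwoPi hp k
  obtain ⟨h1, h2⟩ := mem_Ico.1 hk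
  rw [if_neg (fun h => by have := Nat.le_of_dvd (by omega) h; omega)] at h
  rw [sum_congr rfl fun q _ => by rw [show (k : ℝ) * (q / p) = q * (k / p) by ring], h, zero_div]

theorem sum_range_mul_sub (p n : ℕ) :
    ∑ q ∈ range n, 2 * (q : ℂ) * (p - q) = (n : ℂ) * (n - 1) * (p - (2 * n - 1) / 3) := by
  induction n with
  | zero => simp
  | succ n ih => rw [sum_range_succ, ih]; push_cast; ring

theorem cscSqSum_eq {p : ℕ} (hp : 0 < p) (q : ℕ) :
    cscSqSum p q = ((p : ℂ) ^ 2 - 1) / 3 - 2 * (q % p : ℕ) * (p - (q % p : ℕ)) := by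
  have hp0 : (p : ℂ) ≠ 0 := by exact_mod_cast hp.ne'
  have h := sum_cscSqSum hp
  rw [sum_congr rfl fun q hq => cscSqSum_sub_zero hp q (mem_range.1 hq).le, sum_sub_distrib,
    sum_range_mul_sub, sum_const, card_range, nsmul_eq_mul] at h
  have h0 : cscSqSum p 0 = ((p : ℂ) ^ 2 - 1) / 3 := by
    apply mul_left_cancel₀ hp0
    linear_combination h
  rw [cscSqSum_mod hp, cscSqSum_sub_zero hp _ (Nat.mod_lt _ hp).le, h0]

/-! ### Characters modulo p^N. -/

theorem expTwoPi_div_congr {p N : ℕ} (hp : 0 < p) (R : ℕ) {V W : ℕ} (h : V ≡ W [MOD p ^ N]) :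
    expTwoPi (R * (V / (p : ℝ) ^ N)) = expTwoPi (R * (W / (p : ℝ) ^ N)) := by
  have key : ∀ V : ℕ, expTwoPi (R * (V / (p : ℝ) ^ N))
      = expTwoPi (R * ((V % p ^ N : ℕ) / (p : ℝ) ^ N)) := by
    intro V
    have hp' : (p : ℝ) ^ N ≠ 0 := by positivity
    have hV : (V : ℝ) = (p : ℝ) ^ N * (V / p ^ N : ℕ) + (V % p ^ N : ℕ) := by
      exact_mod_cast (Nat.div_add_mod V (p ^ N)).symm
    rw [hV, show (R : ℝ) * (((p : ℝ) ^ N * (V / p ^ N : ℕ) + (V % p ^ N : ℕ)) / (p : ℝ) ^ N)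
      = (R * (V / p ^ N) : ℕ) + R * ((V % p ^ N : ℕ) / (p : ℝ) ^ N) by push_cast; field_simp,
      expTwoPi_add, expTwoPi_natCast, one_mul]
  rw [key V, key W, h]

/-- The value at `V` of the `k`-th character modulo `p ^ N`. -/
noncomputable def charMod (p N k V : ℕ) : ℂ := expTwoPi (revDigits p N k * (V / (p : ℝ) ^ N))

theorem charMod_succ {p N : ℕ} (hp : 0 < p) {i j : ℕ} (hi : i < p ^ N) (hj : j < p) (V : ℕ) :
    charMod p (N + 1) (i + p ^ N * j) V
      = charMod p N i V * expTwoPi (j * (V / (p : ℝ) ^ (N + 1))) := by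
  have hp' : (p : ℝ) ≠ 0 := by positivity
  rw [charMod, charMod, ← expTwoPi_add, revDigits,
    revDigits_congr (show i + p ^ N * j ≡ i [MOD p ^ N] by simp [Nat.ModEq]),
    Nat.add_mul_div_left _ _ (pow_pos hp N), Nat.div_eq_of_lt hi, zero_add, Nat.mod_eq_of_lt hj]
  congr 1
  push_cast
  field_simp
  ring

theorem expTwoPi_mul_pow {p : ℕ} (hp : 0 < p) (N j q : ℕ) :
    expTwoPi (j * ((p ^ N * q : ℕ) / (p : ℝ) ^ (N + 1))) = expTwoPi (j * (q / p)) := by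
  have hp' : (p : ℝ) ≠ 0 := by positivity
  congr 2
  push_cast
  field_simp
  ring

theorem sum_charMod {p : ℕ} (hp : 0 < p) (N V : ℕ) :
    ∑ k ∈ range (p ^ N), charMod p N k V = if p ^ N ∣ V then (p : ℂ) ^ N else 0 := by
  induction N with
  | zero => simp [charMod, revDigits, expTwoPi_zero]
  | succ N ih =>
    have h1 : ∀ i ∈ range (p ^ N), ∑ j ∈ range p, charMod p (N + 1) (i + p ^ N * j) V
        = charMod p N i V * ∑ j ∈ range p, expTwoPi (j * (V / (p : ℝ) ^ (N + 1))) := by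
      intro i hi
      rw [mul_sum]
      exact sum_congr rfl fun j hj => charMod_succ hp (mem_range.1 hi) (mem_range.1 hj) V
    rw [pow_succ p N, sum_range_mul, sum_congr rfl h1, ← sum_mul, ih]
    by_cases h : p ^ N ∣ V
    · obtain ⟨q, rfl⟩ := h
      rw [if_pos (dvd_mul_right _ _), sum_congr rfl fun j _ => expTwoPi_mul_pow hp N j q,
        sum_expTwoPi hp]
      simp only [mul_dvd_mul_iff_left (pow_pos hp N).ne']
      split_ifs <;> simp [pow_succ]
    · rw [if_neg h, if_neg (fun h' => h ((dvd_mul_right _ _).trans h')), zero_mul]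

/-! ### Coefficients and partial sums of the series. -/

theorem coeff_add_mul {p : ℕ} (hp : 1 < p) (γ : ℝ) {N i j : ℕ} (hi : i < p ^ N)
    (hj : j ∈ Ico 1 p) :
    coeff p γ (i + p ^ N * j)
      = γ / (2 * (p : ℝ) ^ (2 * (N + 1))) *
        (1 / Real.sin (j * Real.pi / p) ^ 2 - 1 / 3) := by
  obtain ⟨h1, h2⟩ := mem_Ico.1 hj
  have hN : 0 < p ^ N := pow_pos (by omega) N
  have hle : p ^ N ≤ i + p ^ N * j := by nlinarith
  have hlen : (Nat.digits p (i + p ^ N * j)).length = N + 1 := by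
    refine le_antisymm ((Nat.digits_length_le_iff hp _).2 ?_)
      ((Nat.lt_digits_length_iff hp _).2 hle)
    rw [pow_succ]; nlinarith
  rw [coeff, if_neg (by omega)]
  simp only [hlen, Nat.add_sub_cancel]
  rw [Nat.getD_digits _ _ hp, Nat.add_mul_div_left _ _ hN, Nat.div_eq_of_lt hi, zero_add,
    Nat.mod_eq_of_lt h2]

/-- The partial sum over `k < p ^ N` of `∑ₖ r_{p,γ}(k) χₖ(V)`. -/
noncomputable def partialSeries (p : ℕ) (γ : ℝ) (N V : ℕ) : ℂ :=
  ∑ k ∈ range (p ^ N), (coeff p γ k : ℂ) * charMod p N k V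

/-- In the block p^N ≤ k < p^(N+1) the coefficient depends only on the leading digit `j`, and the
character splits into a factor for the lower digits and one for `j`, so the double sum factors. -/
theorem partialSeries_succ {p : ℕ} (hp : 1 < p) (γ : ℝ) (N V : ℕ) :
    partialSeries p γ (N + 1) V = partialSeries p γ N V
      + (∑ k ∈ range (p ^ N), charMod p N k V) * ((γ : ℂ) / (2 * (p : ℂ) ^ (2 * (N + 1))) *
        ∑ j ∈ Ico 1 p, expTwoPi (j * (V / (p : ℝ) ^ (N + 1))) *
          (1 / (Real.sin (j * Real.pi / p) : ℂ) ^ 2 - 1 / 3)) := by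
  have hp0 : 0 < p := by omega
  have h1 : ∀ i ∈ range (p ^ N), ∑ j ∈ range p,
      (coeff p γ (i + p ^ N * j) : ℂ) * charMod p (N + 1) (i + p ^ N * j) V
      = (coeff p γ i : ℂ) * charMod p N i V
        + charMod p N i V * ((γ : ℂ) / (2 * (p : ℂ) ^ (2 * (N + 1))) *
        ∑ j ∈ Ico 1 p, expTwoPi (j * (V / (p : ℝ) ^ (N + 1))) *
          (1 / (Real.sin (j * Real.pi / p) : ℂ) ^ 2 - 1 / 3)) := by
    intro i hi
    rw [range_eq_Ico, sum_eq_sum_Ico_succ_bot hp0, charMod_succ hp0 (mem_range.1 hi) hp0, zero_add]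
    congr 1
    · simp [expTwoPi_zero]
    · rw [mul_sum, mul_sum]
      refine sum_congr rfl fun j hj => ?_
      rw [coeff_add_mul hp γ (mem_range.1 hi) hj,
        charMod_succ hp0 (mem_range.1 hi) (mem_Ico.1 hj).2]
      push_cast
      ring
  rw [partialSeries, pow_succ p N, sum_range_mul, sum_congr rfl h1, sum_add_distrib, ← sum_mul]
  rfl

theorem sum_expTwoPi_mul_cscSq {p : ℕ} (hp : 0 < p) (q : ℕ) :
    ∑ j ∈ Ico 1 p, expTwoPi (j * (q / p)) * (1 / (Real.sin (j * Real.pi / p) : ℂ) ^ 2 - 1 / 3)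
      = ((p : ℂ) ^ 2 - 1) / 3 - 2 * (q % p : ℕ) * (p - (q % p : ℕ))
        - ((if p ∣ q then (p : ℂ) else 0) - 1) / 3 := by
  rw [← cscSqSum_eq hp, ← sum_Ico_expTwoPi hp, cscSqSum, sum_div, ← sum_sub_distrib]
  exact sum_congr rfl fun j _ => by ring

theorem partialSeries_eq {p : ℕ} (hp : 1 < p) (γ : ℝ) (N V : ℕ) :
    partialSeries p γ N V = if p ^ N ∣ V then 1 + (γ : ℂ) / 2 - γ / 6 / (p : ℂ) ^ N
      else 1 + (γ : ℂ) / 2 - γ / 2 * (revDist p N V : ℂ) / (p : ℂ) ^ (2 * N) := by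
  have hp0 : 0 < p := by omega
  have hpc : (p : ℂ) ≠ 0 := by exact_mod_cast hp0.ne'
  induction N with
  | zero =>
    simp [partialSeries, charMod, revDigits, expTwoPi_zero, coeff]
    ring
  | succ N ih =>
    rw [partialSeries_succ hp, ih, sum_charMod hp0]
    by_cases h : p ^ N ∣ V
    · obtain ⟨q, rfl⟩ := h
      rw [if_pos (dvd_mul_right _ _), if_pos (dvd_mul_right _ _),
        sum_congr rfl fun j _ => by rw [expTwoPi_mul_pow hp0 N j q],
        sum_expTwoPi_mul_cscSq hp0, revDist_succ_mul hp0, pow_succ p N]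
      simp only [mul_dvd_mul_iff_left (pow_pos hp0 N).ne']
      by_cases hq : p ∣ q
      · rw [if_pos hq, if_pos hq, Nat.mod_eq_zero_of_dvd hq]
        push_cast
        field_simp
        ring
      · rw [if_neg hq, if_neg hq]
        generalize q % p = d
        push_cast
        field_simp
        ring
    · rw [if_neg h, if_neg h,
        if_neg (fun h' => h ((pow_dvd_pow p N.le_succ).trans h')), zero_mul, add_zero,
        revDist_succ_of_not_dvd hp0 h]
      push_cast
      field_simp
      ring

theorem coeff_nonneg {p : ℕ} (hp : 1 < p) {γ : ℝ} (hγ : 0 ≤ γ) (k : ℕ) : 0 ≤ coeff p γ k := by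
  rw [coeff]
  split_ifs with hk
  · positivity
  · have hp0 : 0 < p := by omega
    refine mul_nonneg (by positivity) (sub_nonneg.2 ?_)
    set κ := (Nat.digits p k).getD ((Nat.digits p k).length - 1) 0 with hκ
    have hne : Nat.digits p k ≠ [] := Nat.digits_ne_nil_iff_ne_zero.2 hk
    have hlast : κ = (Nat.digits p k).getLast hne := by
      rw [hκ, List.getLast_eq_getElem, List.getD_eq_getElem]
    have h1 : κ ≠ 0 := by rw [hlast]; exact Nat.getLast_digit_ne_zero p hk
    have h2 : κ < p := by rw [hlast]; exact Nat.digits_lt_base hp (List.getLast_mem hne)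
    have hs := sin_pos_of_mem_Ico (mem_Ico.2 ⟨Nat.one_le_iff_ne_zero.2 h1, h2⟩)
    have hs1 := Real.sin_sq_le_one (κ * Real.pi / p)
    calc (1 : ℝ) / 3 ≤ 1 := by norm_num
      _ ≤ _ := (one_le_div (by positivity)).2 hs1

/-- At V = 0 every character equals 1, so `partialSeries_eq` evaluates the partial sums of the
nonnegative coefficients and bounds them by 1 + γ/2. -/
theorem summable_coeff {p : ℕ} (hp : 1 < p) {γ : ℝ} (hγ : 0 ≤ γ) : Summable (coeff p γ) := by
  have key : ∀ N, ∑ k ∈ range (p ^ N), coeff p γ k ≤ 1 + γ / 2 := by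
    intro N
    have h := partialSeries_eq hp γ N 0
    rw [if_pos (dvd_zero _), partialSeries] at h
    simp only [charMod, Nat.cast_zero, zero_div, mul_zero, expTwoPi_zero, mul_one] at h
    have h' : ∑ k ∈ range (p ^ N), coeff p γ k = 1 + γ / 2 - γ / 6 / (p : ℝ) ^ N := by
      exact_mod_cast h
    rw [h']
    have : 0 ≤ γ / 6 / (p : ℝ) ^ N := by positivity
    linarith
  refine summable_of_sum_range_le (coeff_nonneg hp hγ) (c := 1 + γ / 2) fun n => ?_
  refine le_trans ?_ (key n)
  exact sum_le_sum_of_subset_of_nonneg (range_mono (Nat.lt_pow_self hp).le)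
    fun k _ _ => coeff_nonneg hp hγ k

/-! ### From p-adic integers and real numbers to residues modulo p^N. -/

section Digits
variable (p : ℕ) [Fact p.Prime]

theorem toZModPow_val_modEq (z : ℤ_[p]) {N V : ℕ} (h : PadicInt.toZModPow N z = (V : ZMod (p ^ N)))
    {m : ℕ} (hm : m ≤ N) : (PadicInt.toZModPow m z).val = V % p ^ m := by
  rw [← PadicInt.cast_toZModPow m N hm z, h, ZMod.cast_natCast (pow_dvd_pow p hm), ZMod.val_natCast]

theorem digit_eq (z : ℤ_[p]) {N V : ℕ} (h : PadicInt.toZModPow N z = (V : ZMod (p ^ N)))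
    {r : ℕ} (hr : r < N) : (digit p z r : ℕ) = V / p ^ r % p := by
  rw [digit, Fin.val_ofNat, toZModPow_val_modEq p z h hr, pow_succ, Nat.mod_mul_right_div_self,
    Nat.mod_mod]

theorem sum_ofDigitsTerm_digit (z : ℤ_[p]) {N V : ℕ}
    (h : PadicInt.toZModPow N z = (V : ZMod (p ^ N))) {m : ℕ} (hm : m ≤ N) :
    ∑ r ∈ range m, Real.ofDigitsTerm (digit p z) r = revDigits p m V / (p : ℝ) ^ m := by
  have hp : (p : ℝ) ≠ 0 := by exact_mod_cast (Fact.out : p.Prime).ne_zero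
  induction m with
  | zero => simp [revDigits]
  | succ m ih =>
    rw [sum_range_succ, ih (by omega), Real.ofDigitsTerm, digit_eq p z h hm, revDigits]
    push_cast
    field_simp
    ring

theorem abs_ofDigits_digit_sub_le (z : ℤ_[p]) {N V : ℕ}
    (h : PadicInt.toZModPow N z = (V : ZMod (p ^ N))) :
    |Real.ofDigits (digit p z) - revDigits p N V / (p : ℝ) ^ N| ≤ ((p : ℝ) ^ N)⁻¹ := by
  rw [Real.ofDigits_eq_sum_add_ofDigits _ N, sum_ofDigitsTerm_digit p z h le_rfl,
    add_sub_cancel_left, abs_mul, abs_of_nonneg (by positivity),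
    abs_of_nonneg (Real.ofDigits_nonneg _)]
  exact mul_le_of_le_one_right (by positivity) (Real.ofDigits_le_one _)

theorem monna_natCast {N k : ℕ} (hk : k < p ^ N) :
    monna p (k : ℤ_[p]) = revDigits p N k / (p : ℝ) ^ N := by
  have hp := (Fact.out : p.Prime)
  have h0 : ∀ r ∉ range N, Real.ofDigitsTerm (digit p (k : ℤ_[p])) r = 0 := by
    intro r hr
    rw [Real.ofDigitsTerm, digit_eq p _ (map_natCast (PadicInt.toZModPow (r + 1)) k) r.lt_succ_self,
      Nat.div_eq_of_lt]
    · simp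
    · exact hk.trans_le (Nat.pow_le_pow_right hp.pos (by simpa using hr))
  have hpp : (0 : ℝ) < (p : ℝ) ^ N := by have := hp.pos; positivity
  rw [monna, Real.ofDigits, tsum_eq_sum h0, sum_ofDigitsTerm_digit p _ (map_natCast _ k) le_rfl,
    Int.fract_eq_self]
  refine ⟨by positivity, (div_lt_one hpp).2 ?_⟩
  exact_mod_cast revDigits_lt hp.pos N k

/-- The modulus built into `chi` is the one given by the digit length of `k`; any larger power of
`p` serves, since φ_p(k) is the same fraction at both levels. -/
theorem chi_eq_charMod {N k V : ℕ} (hk : k < p ^ N) (z : ℤ_[p])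
    (h : PadicInt.toZModPow N z = (V : ZMod (p ^ N))) : chi p k z = charMod p N k V := by
  have hp := (Fact.out : p.Prime)
  set a := (Nat.digits p k).length with ha
  have hka : k < p ^ a := Nat.lt_base_pow_length_digits hp.one_lt
  have haN : a ≤ N := (Nat.digits_length_le_iff hp.one_lt k).2 hk
  have h1 : chi p k z = expTwoPi (revDigits p a k * ((V % p ^ a : ℕ) / (p : ℝ) ^ a)) := by
    rw [chi, ← ha, toZModPow_val_modEq p z h haN, monna_natCast p hka, expTwoPi]
    congr 1
    push_cast
    ring
  rw [h1, expTwoPi_div_congr hp.pos _ (Nat.mod_modEq V (p ^ a)), charMod]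
  congr 1
  rw [mul_div_left_comm, ← monna_natCast p hka, monna_natCast p hk, mul_div_left_comm]

theorem chi_mul_conj_chi {N k V : ℕ} (hk : k < p ^ N) (z w : ℤ_[p])
    (h : PadicInt.toZModPow N (z - w) = (V : ZMod (p ^ N))) :
    chi p k z * (starRingEnd ℂ) (chi p k w) = charMod p N k V := by
  set W := (PadicInt.toZModPow N w).val with hW
  have : NeZero (p ^ N) := ⟨pow_ne_zero N (Fact.out : p.Prime).ne_zero⟩
  have hw : PadicInt.toZModPow N w = (W : ZMod (p ^ N)) := by rw [hW, ZMod.natCast_zmod_val]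
  have hz : PadicInt.toZModPow N z = ((V + W : ℕ) : ZMod (p ^ N)) := by
    rw [Nat.cast_add, ← h, ← hw, ← map_add, sub_add_cancel]
  rw [chi_eq_charMod p hk z hz, chi_eq_charMod p hk w hw]
  have : charMod p N k (V + W) = charMod p N k V * charMod p N k W := by
    rw [charMod, charMod, charMod, ← expTwoPi_add]
    push_cast
    ring_nf
  rw [this, mul_assoc, Complex.mul_conj, Complex.normSq_eq_norm_sq, charMod, charMod, norm_expTwoPi]
  simp

theorem norm_chi (k : ℕ) (z : ℤ_[p]) : ‖chi p k z‖ = 1 := by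
  have hp := (Fact.out : p.Prime)
  have : NeZero (p ^ k) := ⟨pow_ne_zero k hp.ne_zero⟩
  rw [chi_eq_charMod p (Nat.lt_pow_self hp.one_lt) z (ZMod.natCast_zmod_val _).symm, charMod,
    norm_expTwoPi]

/-- The natural number whose lowest `N` digits are the first `N` digits of `x`. -/
noncomputable def natDigits (N : ℕ) (x : ℝ) : ℕ :=
  ∑ r ∈ range N, (Real.digits x p r : ℕ) * p ^ r

theorem natDigits_lt (N : ℕ) (x : ℝ) : natDigits p N x < p ^ N := by
  induction N with
  | zero => simp [natDigits]
  | succ N ih =>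
    have h := (Real.digits x p N).isLt
    have : natDigits p (N + 1) x = natDigits p N x + Real.digits x p N * p ^ N :=
      sum_range_succ _ _
    rw [this, pow_succ]
    nlinarith

theorem revDigits_natDigits {x : ℝ} (hx : x ∈ Set.Ico (0 : ℝ) 1) (N : ℕ) :
    revDigits p N (natDigits p N x) = ⌊(p : ℝ) ^ N * x⌋₊ := by
  have hp := (Fact.out : p.Prime)
  induction N with
  | zero => simp [revDigits, Nat.floor_eq_zero.2 hx.2]
  | succ N ih =>
    have h1 : natDigits p (N + 1) x = natDigits p N x + p ^ N * Real.digits x p N := by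
      rw [mul_comm]; exact sum_range_succ _ _
    rw [revDigits, h1, revDigits_congr (show natDigits p N x + p ^ N * Real.digits x p N ≡
      natDigits p N x [MOD p ^ N] by simp [Nat.ModEq]), ih, Nat.add_mul_div_left _ _
      (pow_pos hp.pos N), Nat.div_eq_of_lt (natDigits_lt p N x), zero_add, Real.digits,
      Fin.val_ofNat, Nat.mod_mod, mul_comm x, pow_succ' (p : ℝ), mul_assoc,
      ← Nat.cast_mul_floor_div_cancel (a := (p : ℝ) ^ N * x) hp.ne_zero, Nat.div_add_mod]

theorem toZModPow_monnaInv (N : ℕ) (x : ℝ) :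
    PadicInt.toZModPow N (monnaInv p x) = (natDigits p N x : ZMod (p ^ N)) := by
  have hp := (Fact.out : p.Prime)
  have hp1 : ‖(p : ℤ_[p])‖ < 1 := by
    rw [PadicInt.norm_p]; exact inv_lt_one_of_one_lt₀ (by exact_mod_cast hp.one_lt)
  have hs : ∀ c : ℕ → ℕ, Summable fun r => ((c r : ℕ) : ℤ_[p]) * (p : ℤ_[p]) ^ r := by
    intro c
    refine Summable.of_norm_bounded (summable_geometric_of_lt_one (norm_nonneg _) hp1) fun r => ?_
    rw [norm_mul, norm_pow]
    exact mul_le_of_le_one_left (by positivity) (PadicInt.norm_le_one _)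
  rw [monnaInv, ← (hs _).sum_add_tsum_nat_add N]
  -- The tail of the series is a multiple of p^N and vanishes in the quotient.
  simp_rw [pow_add, ← mul_assoc]
  rw [(hs fun r => Real.digits x p (r + N)).tsum_mul_right, map_add, map_mul]
  have h0 : PadicInt.toZModPow N ((p : ℤ_[p]) ^ N) = 0 := by
    rw [map_pow, map_natCast]
    exact_mod_cast ZMod.natCast_self (p ^ N)
  rw [h0, mul_zero, add_zero, natDigits, map_sum]
  simp

theorem measurable_natDigits (N : ℕ) : Measurable (natDigits p N) := by
  refine Finset.measurable_sum _ fun r _ => ?_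
  have : Measurable fun x : ℝ => ⌊x * (p : ℝ) ^ (r + 1)⌋₊ := (measurable_id.mul_const _).nat_floor
  exact (measurable_from_nat (f := fun n : ℕ => ((Fin.ofNat p n : Fin p) : ℕ) * p ^ r)).comp this

theorem setIntegral_natDigits (N : ℕ) (f : ℕ → ℝ) :
    ∫ σ in Set.Ico (0 : ℝ) 1, f (natDigits p N σ) = (∑ c ∈ range (p ^ N), f c) / (p : ℝ) ^ N := by
  have hp := (Fact.out : p.Prime)
  have hpp : (0 : ℝ) < (p : ℝ) ^ N := by have := hp.pos; positivity
  -- The points of [0, 1) whose first `N` digits form `c` fill one interval of length p^(-N),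
  -- starting at the reversal of `c`.
  set cell : ℕ → Set ℝ := fun c =>
    Set.Ico (revDigits p N c / (p : ℝ) ^ N) ((revDigits p N c + 1) / (p : ℝ) ^ N) with hcell
  have hmem : ∀ σ ∈ Set.Ico (0 : ℝ) 1, ∀ c ∈ range (p ^ N), σ ∈ cell c ↔ c = natDigits p N σ := by
    intro σ hσ c hc
    have h1 : σ ∈ cell c ↔ ⌊(p : ℝ) ^ N * σ⌋₊ = revDigits p N c := by
      rw [Nat.floor_eq_iff (mul_nonneg hpp.le hσ.1), hcell, Set.mem_Ico, div_le_iff₀ hpp,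
        lt_div_iff₀ hpp, mul_comm σ]
    rw [h1, ← revDigits_natDigits p hσ]
    refine ⟨fun h => ?_, fun h => by rw [h]⟩
    exact ((modEq_of_revDigits_eq hp.pos h).eq_of_lt_of_lt (natDigits_lt p N σ)
      (mem_range.1 hc)).symm
  have hsub : ∀ c, cell c ⊆ Set.Ico 0 1 := by
    intro c
    refine Set.Ico_subset_Ico (by positivity) ((div_le_one hpp).2 ?_)
    exact_mod_cast revDigits_lt hp.pos N c
  have hint : ∀ c, ∫ σ in Set.Ico (0 : ℝ) 1, (cell c).indicator (fun _ => f c) σ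
      = f c / (p : ℝ) ^ N := by
    intro c
    rw [setIntegral_indicator measurableSet_Ico, Set.inter_eq_self_of_subset_right (hsub c),
      setIntegral_const, hcell, Real.volume_real_Ico, max_eq_left]
    · rw [smul_eq_mul]; ring
    · rw [← sub_div]; simp
  calc ∫ σ in Set.Ico (0 : ℝ) 1, f (natDigits p N σ)
      = ∫ σ in Set.Ico (0 : ℝ) 1, ∑ c ∈ range (p ^ N), (cell c).indicator (fun _ => f c) σ := by
        refine setIntegral_congr_fun measurableSet_Ico fun σ hσ => ?_
        rw [sum_eq_single_of_mem (natDigits p N σ) (mem_range.2 (natDigits_lt p N σ)),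
          Set.indicator_of_mem ((hmem σ hσ _ (mem_range.2 (natDigits_lt p N σ))).2 rfl)]
        intro c hc hne
        exact Set.indicator_of_notMem (fun h => hne ((hmem σ hσ c hc).1 h)) _
    _ = _ := by
        rw [integral_finsetSum, sum_div, sum_congr rfl fun c _ => hint c]
        intro c _
        exact (integrable_const (f c)).indicator measurableSet_Ico

/-- The residue of `φ_p⁺(x)` modulo `p ^ N` added to the first `N` digits of `σ`. -/
theorem toZModPow_monnaInv_add (N : ℕ) (x σ : ℝ) :
    PadicInt.toZModPow N (monnaInv p x + monnaInv p σ)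
      = ((natDigits p N x + natDigits p N σ : ℕ) : ZMod (p ^ N)) := by
  rw [map_add, toZModPow_monnaInv, toZModPow_monnaInv, Nat.cast_add]

theorem tendsto_inv_pow : Tendsto (fun N : ℕ => ((p : ℝ) ^ N)⁻¹) atTop (𝓝 0) :=
  tendsto_inv_atTop_zero.comp
    (tendsto_pow_atTop_atTop_of_one_lt (by exact_mod_cast (Fact.out : p.Prime).one_lt))

theorem tendsto_revDigits (x σ : ℝ) :
    Tendsto (fun N => (revDigits p N (natDigits p N x + natDigits p N σ) : ℝ) / (p : ℝ) ^ N) atTop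
      (𝓝 (Real.ofDigits (digit p (monnaInv p x + monnaInv p σ)))) := by
  rw [tendsto_iff_dist_tendsto_zero]
  refine squeeze_zero (fun _ => dist_nonneg) (fun N => ?_) (tendsto_inv_pow p)
  rw [dist_comm, Real.dist_eq]
  exact abs_ofDigits_digit_sub_le p _ (toZModPow_monnaInv_add p N x σ)

theorem measurable_shift (x : ℝ) : Measurable (shift p x) := by
  refine Measurable.fract ?_
  refine measurable_of_tendsto_metrizable (fun N => ?_)
    (tendsto_pi_nhds.2 fun σ => tendsto_revDigits p x σ)
  exact (measurable_from_nat (f := fun n : ℕ =>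
    (revDigits p N (natDigits p N x + n) : ℝ) / (p : ℝ) ^ N)).comp (measurable_natDigits p N)

/-- `Int.fract` matters only where the digit series equals 1. There every truncated reversal must be
p^N - 1, which determines all digits of σ, so at most one σ is exceptional. -/
theorem ae_shift_eq (x : ℝ) : ∀ᵐ σ ∂(volume.restrict (Set.Ico (0 : ℝ) 1)),
    shift p x σ = Real.ofDigits (digit p (monnaInv p x + monnaInv p σ)) := by
  have hp := (Fact.out : p.Prime)
  rw [ae_restrict_iff' measurableSet_Ico]
  set E := {σ : ℝ | σ ∈ Set.Ico (0 : ℝ) 1 ∧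
    Real.ofDigits (digit p (monnaInv p x + monnaInv p σ)) = 1} with hE
  have hrev : ∀ σ ∈ E, ∀ N, revDigits p N (natDigits p N x + natDigits p N σ) = p ^ N - 1 := by
    intro σ hσ N
    have hpp : (0 : ℝ) < (p : ℝ) ^ N := by have := hp.pos; positivity
    have h := abs_ofDigits_digit_sub_le p _ (toZModPow_monnaInv_add p N x σ)
    rw [hσ.2, inv_eq_one_div] at h
    have h' := (le_abs_self _).trans h
    rw [sub_le_iff_le_add, ← add_div, one_le_div hpp] at h'
    have h2 : p ^ N ≤ 1 + revDigits p N (natDigits p N x + natDigits p N σ) := by exact_mod_cast h'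
    have := revDigits_lt hp.pos N (natDigits p N x + natDigits p N σ)
    omega
  have hsub : E.Subsingleton := by
    intro σ hσ τ hτ
    have hN : ∀ N, natDigits p N σ = natDigits p N τ := by
      intro N
      have h := modEq_of_revDigits_eq hp.pos ((hrev σ hσ N).trans (hrev τ hτ N).symm)
      exact (Nat.ModEq.add_left_cancel' _ h).eq_of_lt_of_lt (natDigits_lt p N σ) (natDigits_lt p N τ)
    have hfl : ∀ ρ ∈ Set.Ico (0 : ℝ) 1,
        Tendsto (fun N => (revDigits p N (natDigits p N ρ) : ℝ) / (p : ℝ) ^ N) atTop (𝓝 ρ) := by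
      intro ρ hρ
      refine (Real.hasSum_ofDigitsTerm_digits ρ hp.one_lt hρ).tendsto_sum_nat.congr fun N => ?_
      have hpp : (p : ℝ) ^ N ≠ 0 := pow_ne_zero _ (by exact_mod_cast hp.ne_zero)
      rw [revDigits_natDigits p hρ, ← Real.ofDigits_digits_sum_eq hρ N, mul_div_cancel_left₀ _ hpp]
    exact tendsto_nhds_unique (hfl σ hσ.1) (by simpa only [hN] using hfl τ hτ.1)
  have hE0 : volume E = 0 := hsub.measure_zero _
  filter_upwards [compl_mem_ae_iff.2 hE0] with σ hσ hσI
  refine Int.fract_eq_self.2 ⟨Real.ofDigits_nonneg _, lt_of_le_of_ne (Real.ofDigits_le_one _) ?_⟩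
  exact fun h => hσ ⟨hσI, h⟩

end Digits
-- Products of absolutely convergent series.
theorem hasSum_fin_prod {s : ℕ} (f : Fin s → ℕ → ℂ) (a : Fin s → ℂ) (hf : ∀ j, HasSum (f j) (a j))
    (hn : ∀ j, Summable fun k => ‖f j k‖) :
    HasSum (fun k : Fin s → ℕ => ∏ j, f j (k j)) (∏ j, a j) ∧
      Summable fun k : Fin s → ℕ => ‖∏ j, f j (k j)‖ := by
  induction s with
  | zero =>
    simp only [univ_eq_empty, prod_empty]
    exact ⟨hasSum_unique _, (hasSum_unique _).summable⟩
  | succ s ih =>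
    obtain ⟨h1, h2⟩ := ih (fun j => f j.succ) (fun j => a j.succ) (fun j => hf _) (fun j => hn _)
    have h3 := summable_mul_of_summable_norm (hn 0) h2
    have h4 : Summable fun x : ℕ × (Fin s → ℕ) => ‖f 0 x.1 * ∏ j, f j.succ (x.2 j)‖ :=
      summable_norm_iff.2 h3
    have e : ∀ x : ℕ × (Fin s → ℕ), ∏ j, f j (Fin.consEquiv (fun _ => ℕ) x j)
        = f 0 x.1 * ∏ j, f j.succ (x.2 j) := by
      intro x
      rw [Fin.prod_univ_succ]
      simp [Fin.consEquiv]
    constructor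
    · rw [← (Fin.consEquiv fun _ : Fin (s + 1) => ℕ).hasSum_iff, Fin.prod_univ_succ]
      exact ((hf 0).mul h1 h3).congr_fun e
    · rw [← (Fin.consEquiv fun _ : Fin (s + 1) => ℕ).summable_iff]
      exact h4.congr fun x => congrArg norm (e x).symm

/-! ### Averages of the truncated kernel. -/

theorem min_one_sub (a b : ℝ) : min (1 - a) (1 - b) = 1 - (a + b) / 2 - |a - b| / 2 := by
  rw [min_def]
  split_ifs with h
  · rw [abs_of_nonneg (by linarith)]; ring
  · rw [abs_of_nonpos (by linarith)]; ring

theorem sum_revDigits_add {M : Type*} [AddCommGroup M] (p N Z : ℕ) (f : ℕ → M) :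
    ∑ c ∈ range (p ^ N), f (revDigits p N (Z + c)) = ∑ c ∈ range (p ^ N), f (revDigits p N c) :=
  sum_range_add_of_periodic (fun c => f (revDigits p N c)) (p ^ N)
    (fun c => congrArg f (revDigits_congr (by simp [Nat.ModEq]))) Z

/-- The sum is periodic in `c`, so translating by `W` leaves only the difference `V` of the two
points. -/
theorem sum_abs_revDigits (p N : ℕ) {Z W V : ℕ} (h : Z ≡ V + W [MOD p ^ N]) :
    ∑ c ∈ range (p ^ N), |(revDigits p N (Z + c) : ℤ) - revDigits p N (W + c)| = revDist p N V := by
  rw [revDist, ← sum_range_add_of_periodic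
    (fun c => |(revDigits p N (V + c) : ℤ) - revDigits p N c|) (p ^ N) _ W]
  · refine sum_congr rfl fun c _ => ?_
    rw [revDigits_congr (h.add_right c), add_assoc]
  · intro c
    beta_reduce
    rw [← add_assoc, revDigits_congr (show V + c + p ^ N ≡ V + c [MOD p ^ N] by simp [Nat.ModEq]),
      revDigits_congr (show c + p ^ N ≡ c [MOD p ^ N] by simp [Nat.ModEq])]

theorem average_kernel {p : ℕ} (hp : 0 < p) (γ : ℝ) (N : ℕ) {Z W V : ℕ}
    (h : Z ≡ V + W [MOD p ^ N]) :
    (∑ c ∈ range (p ^ N), (1 + γ * min (1 - (revDigits p N (Z + c) : ℝ) / (p : ℝ) ^ N)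
      (1 - (revDigits p N (W + c) : ℝ) / (p : ℝ) ^ N))) / (p : ℝ) ^ N
      = 1 + γ / 2 + γ / 2 * ((p : ℝ) ^ N)⁻¹ - γ / 2 * revDist p N V / (p : ℝ) ^ (2 * N) := by
  have hpp : (0 : ℝ) < (p : ℝ) ^ N := by positivity
  have h1 : ∑ c ∈ range (p ^ N), |(revDigits p N (Z + c) : ℝ) - revDigits p N (W + c)|
      = revDist p N V := by exact_mod_cast sum_abs_revDigits p N h
  have h2 := sum_revDigits p N
  have hZ := sum_revDigits_add p N Z (fun n => (n : ℝ))
  have hW := sum_revDigits_add p N W (fun n => (n : ℝ))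
  have h3 : ∀ c ∈ range (p ^ N), (1 + γ * min (1 - (revDigits p N (Z + c) : ℝ) / (p : ℝ) ^ N)
      (1 - (revDigits p N (W + c) : ℝ) / (p : ℝ) ^ N))
      = (1 + γ) - γ / 2 / (p : ℝ) ^ N * revDigits p N (Z + c)
        - γ / 2 / (p : ℝ) ^ N * revDigits p N (W + c)
        - γ / 2 / (p : ℝ) ^ N * |(revDigits p N (Z + c) : ℝ) - revDigits p N (W + c)| := by
    intro c _
    rw [min_one_sub, ← sub_div, abs_div, abs_of_pos hpp]
    field_simp
    ring
  rw [sum_congr rfl h3, sum_sub_distrib, sum_sub_distrib, sum_sub_distrib, ← mul_sum, ← mul_sum,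
    ← mul_sum, h1, hZ, hW, sum_const, card_range, nsmul_eq_mul]
  set R := ∑ c ∈ range (p ^ N), (revDigits p N c : ℝ)
  have hR : R = (p : ℝ) ^ N * ((p : ℝ) ^ N - 1) / 2 := by linarith
  rw [hR]
  push_cast
  field_simp
  ring

/-! ### The expansion in one dimension. -/

section OneDim
variable (p : ℕ) [Fact p.Prime]

theorem shift_mem_Ico (x σ : ℝ) : shift p x σ ∈ Set.Ico (0 : ℝ) 1 :=
  ⟨Int.fract_nonneg _, Int.fract_lt_one _⟩

theorem norm_kernel_le (γ : ℝ) {a b : ℝ} (ha : a ∈ Set.Icc (0 : ℝ) 1) (hb : b ∈ Set.Icc (0 : ℝ) 1) :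
    ‖1 + γ * min (1 - a) (1 - b)‖ ≤ 1 + |γ| := by
  obtain ⟨ha0, ha1⟩ := ha
  obtain ⟨hb0, hb1⟩ := hb
  have h : |min (1 - a) (1 - b)| ≤ 1 := by
    rw [abs_of_nonneg (le_min (by linarith) (by linarith))]
    exact (min_le_left _ _).trans (by linarith)
  refine (norm_add_le _ _).trans ?_
  rw [norm_one, Real.norm_eq_abs, abs_mul]
  have := mul_le_of_le_one_right (abs_nonneg γ) h
  linarith

theorem measurable_shifted_kernel (γ x y : ℝ) :
    Measurable fun σ => 1 + γ * min (1 - shift p x σ) (1 - shift p y σ) :=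
  measurable_const.add (measurable_const.mul
    ((measurable_const.sub (measurable_shift p x)).min
      (measurable_const.sub (measurable_shift p y))))

theorem integrableOn_shifted_kernel (γ x y : ℝ) :
    IntegrableOn (fun σ => 1 + γ * min (1 - shift p x σ) (1 - shift p y σ))
      (Set.Ico (0 : ℝ) 1) := by
  refine Integrable.of_bound (measurable_shifted_kernel p γ x y).aestronglyMeasurable (1 + |γ|) ?_
  exact ae_of_all _ fun σ => norm_kernel_le γ
    (Set.Ico_subset_Icc_self (shift_mem_Ico p x σ)) (Set.Ico_subset_Icc_self (shift_mem_Ico p y σ))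

/-- The averages are integrals of the kernel with digits cut off at `N`; these integrands are
bounded by 1 + |γ| and converge almost everywhere. -/
theorem tendsto_average_kernel (γ x y : ℝ) :
    Tendsto (fun N => (∑ c ∈ range (p ^ N),
      (1 + γ * min (1 - (revDigits p N (natDigits p N x + c) : ℝ) / (p : ℝ) ^ N)
        (1 - (revDigits p N (natDigits p N y + c) : ℝ) / (p : ℝ) ^ N))) / (p : ℝ) ^ N) atTop
      (𝓝 (∫ σ in Set.Ico (0 : ℝ) 1, (1 + γ * min (1 - shift p x σ) (1 - shift p y σ)))) := by
  have hp := (Fact.out : p.Prime)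
  simp_rw [← setIntegral_natDigits p _ (fun c => 1 + γ * min (1 - (revDigits p _ (_ + c) : ℝ) / _)
        (1 - (revDigits p _ (_ + c) : ℝ) / _))]
  have hmem : ∀ N n, (revDigits p N n : ℝ) / (p : ℝ) ^ N ∈ Set.Icc (0 : ℝ) 1 := by
    intro N n
    have hpp : (0 : ℝ) < (p : ℝ) ^ N := by have := hp.pos; positivity
    refine ⟨by positivity, (div_le_one hpp).2 ?_⟩
    exact_mod_cast (revDigits_lt hp.pos N n).le
  refine tendsto_integral_of_dominated_convergence (fun _ => 1 + |γ|) (fun N => ?_)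
    (integrable_const _) (fun N => ae_of_all _ fun σ => norm_kernel_le γ (hmem _ _) (hmem _ _)) ?_
  · exact ((measurable_from_nat (f := fun c : ℕ =>
      1 + γ * min (1 - (revDigits p N (natDigits p N x + c) : ℝ) / (p : ℝ) ^ N)
        (1 - (revDigits p N (natDigits p N y + c) : ℝ) / (p : ℝ) ^ N))).comp
      (measurable_natDigits p N)).aestronglyMeasurable
  · filter_upwards [ae_shift_eq p x, ae_shift_eq p y] with σ hx hy
    rw [hx, hy]
    exact tendsto_const_nhds.add (tendsto_const_nhds.mul
      ((tendsto_const_nhds.sub (tendsto_revDigits p x σ)).min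
        (tendsto_const_nhds.sub (tendsto_revDigits p y σ))))

theorem norm_term {γ : ℝ} (hγ : 0 ≤ γ) (x y : ℝ) (k : ℕ) :
    ‖(coeff p γ k : ℂ) * beta p k x * (starRingEnd ℂ) (beta p k y)‖ = coeff p γ k := by
  rw [norm_mul, norm_mul, RCLike.norm_conj, beta, beta, norm_chi, norm_chi, mul_one, mul_one,
    Complex.norm_real, Real.norm_eq_abs,
    abs_of_nonneg (coeff_nonneg (Fact.out : p.Prime).one_lt hγ k)]

theorem summable_norm_term {γ : ℝ} (hγ : 0 ≤ γ) (x y : ℝ) :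
    Summable fun k => ‖(coeff p γ k : ℂ) * beta p k x * (starRingEnd ℂ) (beta p k y)‖ :=
  (summable_coeff (Fact.out : p.Prime).one_lt hγ).congr fun k => (norm_term p hγ x y k).symm

theorem hasSum_term {γ : ℝ} (hγ : 0 ≤ γ) (x y : ℝ) :
    HasSum (fun k => (coeff p γ k : ℂ) * beta p k x * (starRingEnd ℂ) (beta p k y))
      ((∫ σ in Set.Ico (0 : ℝ) 1, (1 + γ * min (1 - shift p x σ) (1 - shift p y σ)) : ℝ) : ℂ) := by
  have hp := (Fact.out : p.Prime)
  have hsum := (summable_norm_term p hγ x y).of_norm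
  set T : ℕ → ℂ := fun k => (coeff p γ k : ℂ) * beta p k x * (starRingEnd ℂ) (beta p k y) with hT
  set I := ∫ σ in Set.Ico (0 : ℝ) 1, (1 + γ * min (1 - shift p x σ) (1 - shift p y σ))
  set V : ℕ → ℕ := fun N => (PadicInt.toZModPow N (monnaInv p x - monnaInv p y)).val
  have hV : ∀ N, PadicInt.toZModPow N (monnaInv p x - monnaInv p y) = (V N : ZMod (p ^ N)) := by
    intro N
    have : NeZero (p ^ N) := ⟨pow_ne_zero N hp.ne_zero⟩
    exact (ZMod.natCast_zmod_val _).symm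
  have hmod : ∀ N, natDigits p N x ≡ V N + natDigits p N y [MOD p ^ N] := by
    intro N
    rw [← ZMod.natCast_eq_natCast_iff, Nat.cast_add, ← hV, ← toZModPow_monnaInv,
      ← toZModPow_monnaInv, ← map_add, sub_add_cancel]
  have hS : ∀ N, ∑ k ∈ range (p ^ N), T k = partialSeries p γ N (V N) := by
    intro N
    refine sum_congr rfl fun k hk => ?_
    simp only [hT]
    rw [mul_assoc, beta, beta, chi_mul_conj_chi p (mem_range.1 hk) _ _ (hV N)]
  have hK := tendsto_average_kernel p γ x y
  simp_rw [average_kernel hp.pos γ _ (hmod _)] at hK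
  have hKc := (Complex.continuous_ofReal.tendsto I).comp hK
  have hdiff : Tendsto (fun N => (((1 + γ / 2 + γ / 2 * ((p : ℝ) ^ N)⁻¹
      - γ / 2 * revDist p N (V N) / (p : ℝ) ^ (2 * N) : ℝ)) : ℂ) - ∑ k ∈ range (p ^ N), T k)
      atTop (𝓝 0) := by
    have h0 : Tendsto (fun N => γ * ((p : ℝ) ^ N)⁻¹) atTop (𝓝 0) := by
      simpa using (tendsto_inv_pow p).const_mul γ
    refine squeeze_zero_norm (fun N => ?_) h0
    have hpp : 0 ≤ ((p : ℝ) ^ N)⁻¹ := by positivity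
    rw [hS, partialSeries_eq hp.one_lt]
    -- The discrepancy is (γ/2 + γ/6) p^(-N) in the divisible case and (γ/2) p^(-N) otherwise, both
    -- at most γ p^(-N).
    split_ifs with hd
    · rw [revDist_eq_zero hd]
      have : (((1 + γ / 2 + γ / 2 * ((p : ℝ) ^ N)⁻¹ - γ / 2 * (0 : ℤ) / (p : ℝ) ^ (2 * N) : ℝ)) : ℂ)
          - (1 + (γ : ℂ) / 2 - γ / 6 / (p : ℂ) ^ N) = ((2 / 3 * (γ * ((p : ℝ) ^ N)⁻¹) : ℝ) : ℂ) := by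
        push_cast
        ring
      rw [this, Complex.norm_real, Real.norm_eq_abs, abs_of_nonneg (by positivity)]
      nlinarith [mul_nonneg hγ hpp]
    · have : (((1 + γ / 2 + γ / 2 * ((p : ℝ) ^ N)⁻¹
          - γ / 2 * revDist p N (V N) / (p : ℝ) ^ (2 * N) : ℝ)) : ℂ)
          - (1 + (γ : ℂ) / 2 - γ / 2 * (revDist p N (V N) : ℂ) / (p : ℂ) ^ (2 * N))
          = ((1 / 2 * (γ * ((p : ℝ) ^ N)⁻¹) : ℝ) : ℂ) := by
        push_cast
        ring
      rw [this, Complex.norm_real, Real.norm_eq_abs, abs_of_nonneg (by positivity)]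
      nlinarith [mul_nonneg hγ hpp]
  have hlim : Tendsto (fun N => ∑ k ∈ range (p ^ N), T k) atTop (𝓝 (I : ℂ)) := by
    simpa using hKc.sub hdiff
  -- Summability is already known, so the partial sums along the subsequence p^N determine the sum.
  have hlim' := hsum.hasSum.tendsto_sum_nat.comp
    (pow_right_strictMono₀ hp.one_lt).tendsto_atTop
  exact tendsto_nhds_unique hlim hlim' ▸ hsum.hasSum

end OneDim
end PAdicShift

/-! ### Assembling the coordinates. -/

theorem proposition2 {s : ℕ} (p : Fin s → ℕ) [∀ j, Fact (p j).Prime]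
    (hp : Function.Injective p) (γ : Fin s → ℝ) (hγ : ∀ j, 0 < γ j)
    (x y : Fin s → ℝ) (hx : x ∈ PAdicShift.unitCube s) (hy : y ∈ PAdicShift.unitCube s) :
    MeasureTheory.IntegrableOn
      (fun σ : Fin s → ℝ => PAdicShift.sobolevKernel γ
        (PAdicShift.shiftVec p x σ) (PAdicShift.shiftVec p y σ)) (PAdicShift.unitCube s) ∧
    HasSum
      (fun k : Fin s → ℕ => ((PAdicShift.coeffVec p γ k : ℝ) : ℂ) *
        PAdicShift.betaVec p k x * (starRingEnd ℂ) (PAdicShift.betaVec p k y))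
      ((PAdicShift.shiftInvariantKernel p (PAdicShift.sobolevKernel γ) x y : ℝ) : ℂ) := by
  have hvol : (volume : Measure (Fin s → ℝ)).restrict (PAdicShift.unitCube s)
      = Measure.pi fun _ => (volume : Measure ℝ).restrict (Set.Ico 0 1) := by
    rw [volume_pi, PAdicShift.unitCube, Measure.restrict_pi_pi]
  constructor
  · rw [IntegrableOn, hvol]
    exact Integrable.fintype_prod
      fun j => PAdicShift.integrableOn_shifted_kernel (p j) (γ j) (x j) (y j)
  · have h := (PAdicShift.hasSum_fin_prod _ _
      (fun j => PAdicShift.hasSum_term (p j) (hγ j).le (x j) (y j))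
      (fun j => PAdicShift.summable_norm_term (p j) (hγ j).le (x j) (y j))).1
    have hI : PAdicShift.shiftInvariantKernel p (PAdicShift.sobolevKernel γ) x y
        = ∏ j, ∫ σ in Set.Ico (0 : ℝ) 1, (1 + γ j * min (1 - PAdicShift.shift (p j) (x j) σ)
          (1 - PAdicShift.shift (p j) (y j) σ)) := by
      rw [PAdicShift.shiftInvariantKernel, hvol]
      exact integral_fintype_prod_eq_prod (fun j σ => 1 + γ j *
        min (1 - PAdicShift.shift (p j) (x j) σ) (1 - PAdicShift.shift (p j) (y j) σ))
    rw [hI, Complex.ofReal_prod]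
    refine h.congr_fun fun k => ?_
    rw [PAdicShift.coeffVec, PAdicShift.betaVec, PAdicShift.betaVec, Complex.ofReal_prod, map_prod,
      ← Finset.prod_mul_distrib, ← Finset.prod_mul_distrib]
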